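/- Let $F$ and $K$ be number fields, $v$ a finite place of $F$, $q=\#(\mathcal O_F/v)$, and $G_v\subset G_F=\mathrm{Gal}(\overline F/F)$ a decomposition group at $v$. Let $\lambda$ be a prime of $K$ with residue characteristic $\ell$ and residue field $k_\lambda$, and let $\varepsilon$ be the $\ell$-adic cyclotomic character. Let $\rho\colon G_F\to \mathrm{GL}_2(K_\lambda)$ be a continuous representation which is special at $v$: over $\overline K_\lambda$, the restriction $\rho|_{G_v}$ is isomorphic to a nonsplit extension $$\begin{pmatrix}\varepsilon\chi & \ast\\ 0&\chi\end{pmatrix}$$ for some character $\chi\colon G_v\to\overline K_\lambda^\times$. (For example, $F$ is totally real, $K=K_f$ is the Hecke field of a Hilbert newform $f$ over $F$ whose automorphic representation has a special local component at $v$, $v\nmid\ell$, and $\rho=\rho_{f,\lambda}$ is the Galois representation attached to $f$.) Let $\bar\rho\colon G_F\to\mathrm{GL}_2(k_\lambda)$ be the semisimple reduction of $\rho$ modulo $\lambda$, that is, the semisimplification, as a representation of $G_F$, of the reduction modulo $\lambda$ of an integral model of $\rho$, and let $\mathrm{ad}^0\bar\rho$ be the space of trace-zero $2\times 2$ matrices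 over $k_\lambda$ with $G_F$ acting through $\bar\rho$ by conjugation. Suppose $2(q^2-1)q\not\equiv 0 \bmod \lambda$. Then $H^0(G_v,\mathrm{ad}^0\bar\rho)\neq 0$ if and only if the representation $\mathrm{ad}^0\bar\rho|_{G_v}\otimes_{k_\lambda}\overline{k}_\lambda$ of $G_v$ is semisimple. -/

import Mathlib

open IsDedekindDomain NumberField
open scoped Pointwise MatrixGroups TensorProduct

noncomputable section

namespace SpecialAdjoint

section Padic

variable {K : Type*} [Field K] [NumberField K] (l : HeightOneSpectrum (𝓞 K))
  (ℓ : ℕ) [Fact ℓ.Prime]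

/-- The ring homomorphism from the image of `ℤ` in `ℤ_ℓ` to `K_λ` sending `n` to `n`. -/
def intRangeHom : (Int.castRingHom ℤ_[ℓ]).range →+* l.adicCompletion K :=
  (Int.castRingHom (l.adicCompletion K)).comp
    (RingEquiv.ofLeftInverse
      (f := Int.castRingHom ℤ_[ℓ])
      (Function.leftInverse_invFun (RingHom.injective_int (Int.castRingHom ℤ_[ℓ])))).symm.toRingHom

theorem intRangeHom_apply (n : ℤ) (h) :
    intRangeHom l ℓ ⟨(n : ℤ_[ℓ]), h⟩ = (n : l.adicCompletion K) := by
  have : (RingEquiv.ofLeftInverse (f := Int.castRingHom ℤ_[ℓ])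
      (Function.leftInverse_invFun (RingHom.injective_int (Int.castRingHom ℤ_[ℓ])))).symm
      ⟨(n : ℤ_[ℓ]), h⟩ = n := by
    rw [RingEquiv.symm_apply_eq]; rfl
  change ((_ : ℤ) : l.adicCompletion K) = _
  exact congrArg _ this

theorem intRangeHom_uniformContinuous (hl : (ℓ : 𝓞 K) ∈ l.asIdeal) :
    UniformContinuous (intRangeHom l ℓ) := by
  have hv : Valued.v ((ℓ : ℤ) : l.adicCompletion K) < 1 := by
    have h := HeightOneSpectrum.valuedAdicCompletion_eq_valuation (K := K) l (ℓ : 𝓞 K)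
    have h2 := (l.valuation_lt_one_iff_mem (K := K) (ℓ : 𝓞 K)).2 hl
    rw [← h] at h2
    simpa using h2
  have hint : ∀ n : ℤ, Valued.v (n : l.adicCompletion K) ≤ 1 := fun n =>
    (HeightOneSpectrum.mem_adicCompletionIntegers (𝓞 K) K l).1 (intCast_mem _ n)
  refine uniformContinuous_of_continuousAt_zero (intRangeHom l ℓ) ?_
  have hpow := Valued.tendsto_zero_pow_of_v_lt_one hv
  rw [ContinuousAt, map_zero, (Valued.hasBasis_nhds_zero _ _).tendsto_right_iff]
  intro γ _
  obtain ⟨N, hN⟩ :=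
    ((Valued.hasBasis_nhds_zero _ _).tendsto_right_iff.1 hpow γ trivial).exists
  have hpos : (0 : ℝ) < (ℓ : ℝ) ^ (-N : ℤ) :=
    zpow_pos (by exact_mod_cast (Fact.out : ℓ.Prime).pos) _
  filter_upwards [Metric.ball_mem_nhds _ hpos] with x hx
  obtain ⟨_, n, rfl⟩ := x
  have hx' : ‖(n : ℤ_[ℓ])‖ ≤ (ℓ : ℝ) ^ (-N : ℤ) := by
    simpa [Metric.mem_ball, Subtype.dist_eq] using (Metric.mem_ball.1 hx).le
  obtain ⟨m, rfl⟩ := PadicInt.norm_int_le_pow_iff_dvd.1 hx'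
  have key : intRangeHom l ℓ ⟨Int.castRingHom ℤ_[ℓ] ((ℓ : ℤ) ^ N * m), _, rfl⟩
      = ((ℓ : ℤ) : l.adicCompletion K) ^ N * (m : l.adicCompletion K) := by
    rw [show (((ℓ : ℤ) : l.adicCompletion K) ^ N * (m : l.adicCompletion K))
      = (((ℓ : ℤ) ^ N * m : ℤ) : l.adicCompletion K) by push_cast; rfl]
    exact intRangeHom_apply l ℓ _ _
  simp only [Set.mem_ofPred_eq] at hN ⊢
  rw [Valuation.restrict_lt_iff_lt_embedding] at hN ⊢
  refine lt_of_le_of_lt ?_ hN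
  rw [key, map_mul]
  exact mul_le_of_le_one_right' (hint m)

/-- The structure map `ℤ_ℓ → K_λ` for a prime `λ` of residue characteristic `ℓ`: the continuous
extension of `ℤ → K_λ`. -/
def padicIntHom (hl : (ℓ : 𝓞 K) ∈ l.asIdeal) : ℤ_[ℓ] →+* l.adicCompletion K :=
  IsDenseInducing.extendRingHom (i := (Int.castRingHom ℤ_[ℓ]).range.subtype)
    (f := intRangeHom l ℓ) (isUniformInducing_val _)
    (by
      have h := PadicInt.denseRange_intCast (p := ℓ)
      refine h.mono ?_
      rintro _ ⟨n, rfl⟩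
      exact ⟨⟨(n : ℤ_[ℓ]), n, rfl⟩, rfl⟩)
    (intRangeHom_uniformContinuous l ℓ hl)

end Padic

section Galois

variable (F : Type*) [Field F] [NumberField F]

/-- The decomposition group in `Gal(F̄/F)` of a prime `P` of the ring of integers of `F̄`. When `P`
runs over the primes above a finite place `v`, these are the decomposition groups at `v`. -/
abbrev decompositionGroup (P : Ideal (𝓞 (AlgebraicClosure F))) :
    Subgroup Gal(AlgebraicClosure F/F) :=
  MulAction.stabilizer Gal(AlgebraicClosure F/F) P

variable {F} {K : Type*} [Field K] [NumberField K] (l : HeightOneSpectrum (𝓞 K))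
  (ℓ : ℕ) [Fact ℓ.Prime] (hl : (ℓ : 𝓞 K) ∈ l.asIdeal)

/-- The `ℓ`-adic cyclotomic character of `Gal(F̄/F)`, with values in `K_λ`. -/
def cyclo (g : Gal(AlgebraicClosure F/F)) : l.adicCompletion K :=
  padicIntHom l ℓ hl (cyclotomicCharacter (AlgebraicClosure F) ℓ g.toRingEquiv : ℤ_[ℓ])

/-- `ρ` is special at the place below `P`: over an algebraic closure of `K_λ`, the restriction of
`ρ` to the decomposition group is a nonsplit extension of `χ` by `εχ`, for some character `χ`.
(Continuity of `χ` is automatic from that of `ρ`.) -/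
def IsSpecialAt (P : Ideal (𝓞 (AlgebraicClosure F)))
    (ρ : Gal(AlgebraicClosure F/F) →* GL (Fin 2) (l.adicCompletion K)) : Prop :=
  let ι := algebraMap (l.adicCompletion K) (AlgebraicClosure (l.adicCompletion K))
  ∃ χ : decompositionGroup F P →* (AlgebraicClosure (l.adicCompletion K))ˣ,
    (∃ (A : GL (Fin 2) (AlgebraicClosure (l.adicCompletion K)))
        (b : decompositionGroup F P → AlgebraicClosure (l.adicCompletion K)),
      ∀ g : decompositionGroup F P,
        (A * Matrix.GeneralLinearGroup.map ι (ρ g) * A⁻¹).val = !![ι (cyclo l ℓ hl g.1) * χ g, b g; 0, χ g]) ∧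
    ¬ ∃ A : GL (Fin 2) (AlgebraicClosure (l.adicCompletion K)),
      ∀ g : decompositionGroup F P,
        (A * Matrix.GeneralLinearGroup.map ι (ρ g) * A⁻¹).val = !![ι (cyclo l ℓ hl g.1) * χ g, 0; 0, χ g]

end Galois

section Residual

variable {G : Type*} [Group G] {k : Type*} [Field k]

/-- The representation on column vectors given by a homomorphism to `GL₂(k)`. -/
def stdRep (r : G →* GL (Fin 2) k) : Representation k G (Fin 2 → k) :=
  (Units.coeHom _).comp (Matrix.GeneralLinearGroup.toLin.toMonoidHom.comp r)

/-- `s` is (isomorphic to) the semisimplification of the two-dimensional representation `r`: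
either `r` is irreducible and `s ≅ r`, or `r` is an extension of a character `b` by a character
`a` and `s ≅ a ⊕ b`. -/
def IsSemisimplification (r s : G →* GL (Fin 2) k) : Prop :=
  ((stdRep r).IsIrreducible ∧ ∃ A : GL (Fin 2) k, ∀ g, s g = A * r g * A⁻¹) ∨
  ∃ (a b : G →* kˣ) (c : G → k) (A B : GL (Fin 2) k), ∀ g,
    (A * r g * A⁻¹).val = !![(a g : k), c g; 0, (b g : k)] ∧
    (B * s g * B⁻¹).val = !![(a g : k), 0; 0, (b g : k)]

variable {K : Type*} [Field K] [NumberField K] (l : HeightOneSpectrum (𝓞 K))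

/-- The residue field `k_λ` of `K` at `λ`, as the residue field of the integers of `K_λ`. -/
abbrev resField : Type _ := IsLocalRing.ResidueField (l.adicCompletionIntegers K)

/-- `ρ'` is the semisimple residual representation of `ρ`: the semisimplification of the
reduction modulo `λ` of an integral model of `ρ`. -/
def IsSemisimpleReduction (ρ : G →* GL (Fin 2) (l.adicCompletion K))
    (ρ' : G →* GL (Fin 2) (resField l)) : Prop :=
  ∃ (ρ₀ : G →* GL (Fin 2) (l.adicCompletionIntegers K)) (A : GL (Fin 2) (l.adicCompletion K)),
    (∀ g, Matrix.GeneralLinearGroup.map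
        (algebraMap (l.adicCompletionIntegers K) (l.adicCompletion K)) (ρ₀ g)
      = A * ρ g * A⁻¹) ∧
    IsSemisimplification
      ((Matrix.GeneralLinearGroup.map
        (IsLocalRing.residue (l.adicCompletionIntegers K))).comp ρ₀) ρ'

/-- The trace-zero `2 × 2` matrices. -/
abbrev TraceZero (k : Type*) [Field k] : Submodule k (Matrix (Fin 2) (Fin 2) k) :=
  LinearMap.ker (Matrix.traceLinearMap (Fin 2) k k)

/-- `ad⁰ r`: the conjugation action on trace-zero matrices. -/
def adZero (r : G →* GL (Fin 2) k) : Representation k G (TraceZero k) where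
  toFun g :=
    { toFun := fun X => ⟨(r g).val * X.1 * (r g)⁻¹.val, by
        have hX : Matrix.trace X.1 = 0 := X.2
        change Matrix.trace ((r g).val * X.1 * (r g)⁻¹.val) = 0
        rw [Matrix.trace_mul_comm, ← mul_assoc, ← Units.val_mul, inv_mul_cancel,
          Units.val_one, one_mul, hX]⟩
      map_add' := fun X Y => Subtype.ext (by simp [mul_add, add_mul])
      map_smul' := fun c X => Subtype.ext (by simp) }
  map_one' := by ext1 X; exact Subtype.ext (by simp)
  map_mul' g h := by
    ext1 X
    exact Subtype.ext (by simp only [map_mul, mul_inv_rev, Units.val_mul]; simp [mul_assoc])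

/-- Extension of scalars `L ⊗_k V` of a representation `V` over `k`. -/
def extendScalars (L : Type*) [Field L] [Algebra k L] {V : Type*} [AddCommGroup V] [Module k V]
    (r : Representation k G V) : Representation L G (L ⊗[k] V) :=
  (Module.End.baseChangeHom k L V).toRingHom.toMonoidHom.comp r

end Residual

end SpecialAdjoint

end

/-! Everything comes down to the fact that `ρ'` restricted to the decomposition group is either
diagonal or triangular with distinct diagonal characters.

If the reduction of the integral model is reducible over the whole Galois group, `ρ'` is a sum of
two characters. Then `diag(1, -1)` is invariant and `ad⁰` has a basis of eigenvectors, so both sides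
hold.

Otherwise `ρ'` is conjugate to the reduction itself. At a Frobenius `g₀` the ratio of the two
characters is `e = ε(g₀) ≡ q`, and `q² ≠ 1` in the residue field. As `e + 1` is a unit, `t = χ(g₀)`
is read off from the trace and lies in the integers. The matrix `D = ρ₀(g₀) - t` has columns on the
line where the group acts by `εχ`, and its trace `(e - 1)t` is a unit, so its reduction still
provides a stable line (`exists_residual_triangular`).

For a triangular `r` with distinct diagonal characters, both conditions amount to diagonalizability.
An invariant trace-zero matrix makes the upper-right entry a multiple of the difference of the
characters, and a unipotent conjugation removes it. Conversely, semisimplicity splits the extension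
of the trivial character by `a/d` inside `ad⁰`; the splitting descends from the algebraic closure
because `a/d ≠ 1` at `g₀`. -/

namespace SpecialAdjoint

open Representation

/-! ### Semisimplicity from common eigenvectors. -/

section Semisimple

variable {G : Type*} [Group G] {k : Type*} [Field k]

/-- A representation spanned by common eigenvectors is semisimple. -/
theorem isSemisimpleRepresentation_of_span_eigenvectors {V : Type*} [AddCommGroup V] [Module k V]
    (r : Representation k G V) {ι : Type*} (e : ι → V) (he : Submodule.span k (Set.range e) = ⊤)
    (c : ι → G → k) (hc : ∀ i g, r g (e i) = c i g • e i) : r.IsSemisimpleRepresentation := by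
  rw [isSemisimpleRepresentation_iff_isSemisimpleModule_asModule]
  let S : ι → Subrepresentation r := fun i =>
    { toSubmodule := Submodule.span k {e i}
      apply_mem_toSubmodule := fun g v hv => by
        obtain ⟨a, rfl⟩ := Submodule.mem_span_singleton.1 hv
        rw [map_smul, hc]
        exact Submodule.smul_mem _ _ (Submodule.smul_mem _ _ (Submodule.mem_span_singleton_self _)) }
  have hS : ∀ i (v : V), v ∈ (S i).toSubmodule ↔ ∃ a : k, a • e i = v := fun i v =>
    Submodule.mem_span_singleton
  refine isSemisimpleModule_of_isSemisimpleModule_submodule'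
    (p := fun i => (S i).asSubmodule) (fun i => ?_) ?_
  · rw [isSemisimpleModule_iff, (OrderIso.complementedLattice_iff (Submodule.mapIic _))]
    -- A stable subspace of the line through `e i` is everything or zero, according to whether it
    -- contains `e i`.
    refine ⟨fun N => ?_⟩
    obtain ⟨N, hN⟩ := N
    by_cases h : e i ∈ N
    · have : N = (S i).asSubmodule := le_antisymm hN fun v hv => by
        obtain ⟨a, rfl⟩ := (hS i v).1 hv
        exact (Subrepresentation.ofSubmodule' N).toSubmodule.smul_mem a h
      subst this
      exact ⟨⊥, isCompl_top_bot⟩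
    · have : N = ⊥ := (Submodule.eq_bot_iff _).2 fun v hv => by
        obtain ⟨a, rfl⟩ := (hS i v).1 (hN hv)
        by_cases ha : a = 0
        · rw [ha, zero_smul]
          rfl
        · refine absurd ?_ h
          have := (Subrepresentation.ofSubmodule' N).toSubmodule.smul_mem a⁻¹ hv
          rw [smul_smul, inv_mul_cancel₀ ha, one_smul] at this
          exact this
      subst this
      exact ⟨⊤, isCompl_bot_top⟩
  · rw [eq_top_iff]
    intro (v : V) _
    have hv : v ∈ Submodule.span k (Set.range e) := he ▸ Submodule.mem_top
    have hle : Submodule.span k (Set.range e) ≤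
        (Subrepresentation.ofSubmodule' (⨆ i, (S i).asSubmodule)).toSubmodule := by
      rw [Submodule.span_le]
      rintro _ ⟨i, rfl⟩
      exact Submodule.mem_iSup_of_mem (p := fun i => (S i).asSubmodule) i
        ((hS i _).2 ⟨1, one_smul _ _⟩)
    exact hle hv

end Semisimple

/-! ### The adjoint representation of a triangular representation. -/

section Adjoint

variable {G : Type*} [Group G] {k : Type*} [Field k]

/-- The trace-zero matrix `B⁻¹ * !![x, y; z, -x] * B`. -/
def conjTraceZero (B : GL (Fin 2) k) (x y z : k) : TraceZero k :=
  ⟨B⁻¹.val * !![x, y; z, -x] * B.val, by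
    change Matrix.trace (B⁻¹.val * !![x, y; z, -x] * B.val) = 0
    rw [Matrix.trace_mul_comm, ← mul_assoc, ← Units.val_mul, mul_inv_cancel, Units.val_one,
      one_mul, Matrix.trace_fin_two]
    simp⟩

theorem exists_conjTraceZero_eq (B : GL (Fin 2) k) (X : TraceZero k) :
    ∃ x y z, X = conjTraceZero B x y z := by
  have h : Matrix.trace (B.val * X.1 * B⁻¹.val) = 0 := by
    rw [Matrix.trace_mul_comm, ← mul_assoc, ← Units.val_mul, inv_mul_cancel, Units.val_one,
      one_mul]
    exact X.2
  rw [Matrix.trace_fin_two] at h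
  refine ⟨(B.val * X.1 * B⁻¹.val) 0 0, (B.val * X.1 * B⁻¹.val) 0 1, (B.val * X.1 * B⁻¹.val) 1 0,
    Subtype.ext ?_⟩
  change _ = B⁻¹.val * !![_, _; _, _] * B.val
  rw [← eq_neg_of_add_eq_zero_right h, ← Matrix.eta_fin_two]
  have e : B⁻¹.val * B.val = 1 := by rw [← Units.val_mul, inv_mul_cancel, Units.val_one]
  calc X.1 = (B⁻¹.val * B.val) * X.1 * (B⁻¹.val * B.val) := by rw [e, one_mul, mul_one]
    _ = _ := by simp only [mul_assoc]

theorem conjTraceZero_inj (B : GL (Fin 2) k) {x y z x' y' z' : k} :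
    conjTraceZero B x y z = conjTraceZero B x' y' z' ↔ x = x' ∧ y = y' ∧ z = z' := by
  refine ⟨fun h => ?_, by rintro ⟨rfl, rfl, rfl⟩; rfl⟩
  have h1 : B⁻¹.val * !![x, y; z, -x] * B.val = B⁻¹.val * !![x', y'; z', -x'] * B.val :=
    congrArg Subtype.val h
  rw [Units.mul_left_inj, Units.mul_right_inj] at h1
  have h00 := congrFun (congrFun h1 0) 0
  have h01 := congrFun (congrFun h1 0) 1
  have h10 := congrFun (congrFun h1 1) 0
  simp at h00 h01 h10
  exact ⟨h00, h01, h10⟩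

theorem conjTraceZero_add (B : GL (Fin 2) k) (x y z x' y' z' : k) :
    conjTraceZero B x y z + conjTraceZero B x' y' z'
      = conjTraceZero B (x + x') (y + y') (z + z') := by
  refine Subtype.ext ?_
  change B⁻¹.val * _ * B.val + B⁻¹.val * _ * B.val = B⁻¹.val * _ * B.val
  rw [← add_mul, ← mul_add]
  congr 2
  ext i j; fin_cases i <;> fin_cases j <;> simp [add_comm]

theorem smul_conjTraceZero (B : GL (Fin 2) k) (c x y z : k) :
    c • conjTraceZero B x y z = conjTraceZero B (c * x) (c * y) (c * z) := by
  refine Subtype.ext ?_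
  change c • (B⁻¹.val * _ * B.val) = B⁻¹.val * _ * B.val
  rw [← smul_mul_assoc, ← mul_smul_comm]
  congr 2
  ext i j; fin_cases i <;> fin_cases j <;> simp

theorem conjTraceZero_zero (B : GL (Fin 2) k) : conjTraceZero B 0 0 0 = 0 := by
  simpa using (smul_conjTraceZero B 0 0 0 0).symm

/-- If `B * r g * B⁻¹ = T`, the adjoint action of `g` is conjugation by `T` in the basis
given by `B`. -/
theorem adZero_conjTraceZero_iff (r : G →* GL (Fin 2) k) (B : GL (Fin 2) k) (g : G)
    {T : Matrix (Fin 2) (Fin 2) k} (hT : (B * r g * B⁻¹).val = T) (x y z x' y' z' : k) :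
    adZero r g (conjTraceZero B x y z) = conjTraceZero B x' y' z' ↔
      T * !![x, y; z, -x] = !![x', y'; z', -x'] * T := by
  have key : adZero r g (conjTraceZero B x y z) = conjTraceZero B x' y' z' ↔
      (r g).val * (B⁻¹.val * !![x, y; z, -x] * B.val) * (r g)⁻¹.val =
        B⁻¹.val * !![x', y'; z', -x'] * B.val := Subtype.ext_iff
  rw [key, Units.mul_inv_eq_iff_eq_mul, ← Units.mul_right_inj B, ← Units.mul_left_inj B⁻¹, ← hT]
  have e' : B.val * B⁻¹.val = 1 := by rw [← Units.val_mul, mul_inv_cancel, Units.val_one]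
  generalize !![x, y; z, -x] = Y
  generalize !![x', y'; z', -x'] = Y'
  have h1 : B.val * ((r g).val * (B⁻¹.val * Y * B.val)) * B⁻¹.val =
      (B * r g * B⁻¹).val * Y := by
    rw [Units.val_mul, Units.val_mul]
    calc _ = B.val * (r g).val * B⁻¹.val * Y * (B.val * B⁻¹.val) := by simp only [mul_assoc]
      _ = _ := by rw [e', mul_one]
  have h2 : B.val * (B⁻¹.val * Y' * B.val * (r g).val) * B⁻¹.val =
      Y' * (B * r g * B⁻¹).val := by
    rw [Units.val_mul, Units.val_mul]
    calc _ = (B.val * B⁻¹.val) * Y' * (B.val * (r g).val * B⁻¹.val) := by simp only [mul_assoc]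
      _ = _ := by rw [e', one_mul]
  rw [h1, h2]

theorem extendScalars_tmul (L : Type*) [Field L] [Algebra k L] {V : Type*} [AddCommGroup V]
    [Module k V] (r : Representation k G V) (g : G) (x : L) (v : V) :
    extendScalars L r g (x ⊗ₜ v) = x ⊗ₜ r g v := rfl

/-- In the diagonalizing basis, `diag(1, -1)` commutes with every `r g`. -/
theorem adZero_invariants_ne_bot_of_diagonal (r : G →* GL (Fin 2) k)
    (B : GL (Fin 2) k) (a d : G → k) (hr : ∀ g, (B * r g * B⁻¹).val = !![a g, 0; 0, d g]) :
    (adZero r).invariants ≠ ⊥ := by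
  intro h
  have hmem : conjTraceZero B 1 0 0 ∈ (adZero r).invariants := fun g => by
    rw [adZero_conjTraceZero_iff r B g (hr g)]
    ext i j; fin_cases i <;> fin_cases j <;> simp
  rw [h, Submodule.mem_bot, ← conjTraceZero_zero B, conjTraceZero_inj] at hmem
  exact one_ne_zero hmem.1

theorem diag_ne_zero_of_triangular {T : GL (Fin 2) k} {a c d : k} (hT : T.val = !![a, c; 0, d]) :
    a ≠ 0 ∧ d ≠ 0 := by
  have h : IsUnit T.val.det := (Matrix.isUnit_iff_isUnit_det _).1 T.isUnit
  rw [hT, Matrix.det_fin_two_of, mul_zero, sub_zero] at h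
  exact mul_ne_zero_iff.1 h.ne_zero

/-- Conjugation by `diag(a, d)` scales `diag(1, -1)` and the two off-diagonal matrix units by `1`,
`a/d`, `d/a`; this eigenbasis survives extension of scalars. -/
theorem extendScalars_adZero_isSemisimple_of_diagonal (L : Type*) [Field L] [Algebra k L]
    (r : G →* GL (Fin 2) k) (B : GL (Fin 2) k) (a d : G → k)
    (hr : ∀ g, (B * r g * B⁻¹).val = !![a g, 0; 0, d g]) :
    (extendScalars L (adZero r)).IsSemisimpleRepresentation := by
  let b : Fin 3 → TraceZero k :=
    ![conjTraceZero B 1 0 0, conjTraceZero B 0 1 0, conjTraceZero B 0 0 1]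
  let w : Fin 3 → G → k := ![fun _ => 1, fun g => a g / d g, fun g => d g / a g]
  have hb : Submodule.span k (Set.range b) = ⊤ := by
    rw [eq_top_iff]
    rintro X -
    obtain ⟨x, y, z, rfl⟩ := exists_conjTraceZero_eq B X
    have : conjTraceZero B x y z = x • b 0 + y • b 1 + z • b 2 := by
      simp [b, smul_conjTraceZero, conjTraceZero_add]
    rw [this]
    exact add_mem (add_mem (Submodule.smul_mem _ _ (Submodule.subset_span ⟨0, rfl⟩))
      (Submodule.smul_mem _ _ (Submodule.subset_span ⟨1, rfl⟩)))
      (Submodule.smul_mem _ _ (Submodule.subset_span ⟨2, rfl⟩))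
  have hw : ∀ i g, adZero r g (b i) = w i g • b i := by
    intro i g
    obtain ⟨ha, hd⟩ := diag_ne_zero_of_triangular (hr g)
    fin_cases i
    all_goals
      simp only [b, w, Fin.zero_eta, Fin.mk_one, Fin.reduceFinMk, Matrix.cons_val]
      rw [smul_conjTraceZero, adZero_conjTraceZero_iff r B g (hr g)]
      ext i j; fin_cases i <;> fin_cases j <;> simp [ha, hd]
  refine isSemisimpleRepresentation_of_span_eigenvectors _ (fun i => (1 : L) ⊗ₜ[k] b i) ?_
    (fun i g => algebraMap k L (w i g)) fun i g => ?_
  · have := Submodule.baseChange_span (A := L) (M := TraceZero k) (R := k) (Set.range b)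
    rw [hb, Submodule.baseChange_top, ← Set.range_comp] at this
    exact this.symm
  · rw [extendScalars_tmul, hw, TensorProduct.tmul_smul, algebraMap_smul]

/-- A nonzero invariant matrix is upper triangular with nonzero diagonal because `a ≠ d` at `g₀`,
and its two eigenlines, distinct as `2 ≠ 0`, are stable. -/
theorem exists_diagonal_of_invariants_ne_bot (h2 : (2 : k) ≠ 0) (r : G →* GL (Fin 2) k)
    (B : GL (Fin 2) k) (a c d : G → k) (hr : ∀ g, (B * r g * B⁻¹).val = !![a g, c g; 0, d g])
    (g₀ : G) (hg₀ : a g₀ ≠ d g₀) (hinv : (adZero r).invariants ≠ ⊥) :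
    ∃ B' : GL (Fin 2) k, ∀ g, (B' * r g * B'⁻¹).val = !![a g, 0; 0, d g] := by
  obtain ⟨X, hX, hX0⟩ := Submodule.exists_mem_ne_zero_of_ne_bot hinv
  obtain ⟨p, q, s, rfl⟩ := exists_conjTraceZero_eq B X
  have hcomm : ∀ g, s * (a g - d g) = 0 ∧ a g * q - c g * p = p * c g + q * d g := fun g => by
    have h := (adZero_conjTraceZero_iff r B g (hr g) _ _ _ _ _ _).1 (hX g)
    have h01 := congrFun (congrFun h 0) 1
    have h10 := congrFun (congrFun h 1) 0
    simp [Matrix.mul_apply, Fin.sum_univ_two] at h01 h10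
    exact ⟨by linear_combination -h10, by linear_combination h01⟩
  have hs : s = 0 := (mul_eq_zero.1 (hcomm g₀).1).resolve_right (sub_ne_zero.2 hg₀)
  have hp : p ≠ 0 := by
    rintro rfl
    refine hX0 ?_
    have hq : q * (a g₀ - d g₀) = 0 := by linear_combination (hcomm g₀).2
    rw [hs, (mul_eq_zero.1 hq).resolve_right (sub_ne_zero.2 hg₀), conjTraceZero_zero]
  -- The commutation relation reads `2pc = q(a - d)`, so `c = u(a - d)`, which is cancelled by
  -- conjugating with the unipotent matrix of entry `u`.
  let u : k := q / (2 * p)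
  have hu : ∀ g, c g = u * (a g - d g) := fun g => by
    simp only [u]
    field_simp
    linear_combination -(hcomm g).2
  let U : GL (Fin 2) k := ⟨!![1, u; 0, 1], !![1, -u; 0, 1],
    by ext i j; fin_cases i <;> fin_cases j <;> simp,
    by ext i j; fin_cases i <;> fin_cases j <;> simp⟩
  refine ⟨U * B, fun g => ?_⟩
  have : U * B * r g * (U * B)⁻¹ = U * (B * r g * B⁻¹) * U⁻¹ := by group
  rw [this, Units.val_mul, Units.val_mul, hr, hu]
  change !![1, u; 0, 1] * _ * !![1, -u; 0, 1] = _
  ext i j; fin_cases i <;> fin_cases j <;> simp [Matrix.mul_apply, Fin.sum_univ_two]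
  ring

/-- In a semisimple representation, an extension of the trivial representation by a character
`α` splits: its cocycle `β` is a coboundary. -/
theorem exists_coboundary_of_isSemisimple {V : Type*} [AddCommGroup V] [Module k V]
    (r : Representation k G V) (hss : r.IsSemisimpleRepresentation) (e h : V) (he : e ≠ 0)
    (α β : G → k) (hge : ∀ g, r g e = α g • e) (hgh : ∀ g, r g h = h + β g • e) :
    ∃ x : k, ∀ g, β g = x * (α g - 1) := by
  let W : Subrepresentation r :=
    { toSubmodule := Submodule.span k {e}
      apply_mem_toSubmodule := fun g v hv => by
        obtain ⟨x, rfl⟩ := Submodule.mem_span_singleton.1 hv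
        rw [map_smul, hge]
        exact Submodule.smul_mem _ _ (Submodule.smul_mem _ _
          (Submodule.mem_span_singleton_self _)) }
  obtain ⟨C, hC⟩ := hss.exists_isCompl W
  have htop : h ∈ W.toSubmodule ⊔ C.toSubmodule := by
    have : W.toSubmodule ⊔ C.toSubmodule = ⊤ :=
      congrArg Subrepresentation.toSubmodule hC.sup_eq_top
    rw [this]
    exact Submodule.mem_top
  obtain ⟨y, hy, z, hz, hyz⟩ := Submodule.mem_sup.1 htop
  obtain ⟨x, rfl⟩ := Submodule.mem_span_singleton.1 hy
  have hbot : W.toSubmodule ⊓ C.toSubmodule = ⊥ :=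
    congrArg Subrepresentation.toSubmodule hC.inf_eq_bot
  have hz' : z = h - x • e := eq_sub_of_add_eq' hyz
  refine ⟨x, fun g => ?_⟩
  -- The component `z` of `h` in the complement moves only along `e`; since the complement is
  -- stable, it does not move at all.
  have h1 : r g z - z = (β g - x * (α g - 1)) • e := by
    rw [hz', map_sub, map_smul, hge, hgh]
    module
  have h2 : r g z - z ∈ W.toSubmodule ⊓ C.toSubmodule :=
    ⟨h1 ▸ Submodule.smul_mem _ _ (Submodule.mem_span_singleton_self _),
      sub_mem (C.apply_mem_toSubmodule g hz) hz⟩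
  rw [hbot, Submodule.mem_bot, h1, smul_eq_zero] at h2
  exact sub_eq_zero.1 (h2.resolve_right he)

/-- Let `e` span a line on which `G` acts by a character that is nontrivial at `g₀`, and let `h`
be invariant modulo `e`. If the representation is semisimple after extension of scalars, then some
`h + x • e` is invariant. -/
theorem exists_add_smul_mem_invariants (L : Type*) [Field L] [Algebra k L] {V : Type*}
    [AddCommGroup V] [Module k V] (r : Representation k G V) (e h : V) (he : e ≠ 0) (α β : G → k)
    (hge : ∀ g, r g e = α g • e) (hgh : ∀ g, r g h = h + β g • e) (g₀ : G) (hg₀ : α g₀ ≠ 1)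
    (hss : (extendScalars L r).IsSemisimpleRepresentation) :
    ∃ x : k, h + x • e ∈ r.invariants := by
  obtain ⟨x, hx⟩ := exists_coboundary_of_isSemisimple (extendScalars L r) hss
    ((1 : L) ⊗ₜ[k] e) ((1 : L) ⊗ₜ[k] h)
    (fun h0 => he (Module.FaithfullyFlat.tensorProduct_mk_injective (A := k) (B := L) V
      (by simpa using h0)))
    (fun g => algebraMap k L (α g)) (fun g => algebraMap k L (β g))
    (fun g => by rw [extendScalars_tmul, hge, TensorProduct.tmul_smul, algebraMap_smul])
    (fun g => by rw [extendScalars_tmul, hgh, TensorProduct.tmul_add, TensorProduct.tmul_smul,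
      algebraMap_smul])
  have hne : algebraMap k L (α g₀) - 1 ≠ 0 := by
    rw [sub_ne_zero, Ne, ← map_one (algebraMap k L), (algebraMap k L).injective.eq_iff]
    exact hg₀
  -- Evaluating the coboundary relation at `g₀` shows that `x` comes from `k`.
  have hx₀ : x = algebraMap k L (β g₀ / (α g₀ - 1)) := by
    rw [map_div₀, map_sub, map_one, eq_div_iff hne, hx g₀]
  have hx' : ∀ g, β g = β g₀ / (α g₀ - 1) * (α g - 1) := fun g =>
    (algebraMap k L).injective (by rw [hx g, hx₀, map_mul, map_sub (algebraMap k L) (α g), map_one])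
  refine ⟨-(β g₀ / (α g₀ - 1)), fun g => ?_⟩
  rw [map_add, map_smul, hge, hgh]
  nth_rewrite 1 [hx' g]
  generalize β g₀ / (α g₀ - 1) = y
  module

/-- The upper matrix unit `E` spans a line with character `a/d`, and `H = diag(1, -1)` goes to `H -
(2c/d)E`. Splitting this extension gives an invariant `H + xE`, nonzero since its coefficient on `H`
is `1`. -/
theorem adZero_invariants_ne_bot_of_isSemisimple (L : Type*) [Field L] [Algebra k L]
    (r : G →* GL (Fin 2) k)
    (B : GL (Fin 2) k) (a c d : G → k) (hr : ∀ g, (B * r g * B⁻¹).val = !![a g, c g; 0, d g])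
    (g₀ : G) (hg₀ : a g₀ ≠ d g₀)
    (hss : (extendScalars L (adZero r)).IsSemisimpleRepresentation) :
    (adZero r).invariants ≠ ⊥ := by
  have hd : ∀ g, d g ≠ 0 := fun g => (diag_ne_zero_of_triangular (hr g)).2
  obtain ⟨x, hx⟩ := exists_add_smul_mem_invariants L (adZero r) (conjTraceZero B 0 1 0)
    (conjTraceZero B 1 0 0)
    (by rw [Ne, ← conjTraceZero_zero B, conjTraceZero_inj]; simp)
    (fun g => a g / d g) (fun g => -2 * c g / d g)
    (fun g => by
      rw [smul_conjTraceZero, adZero_conjTraceZero_iff r B g (hr g)]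
      have := hd g
      ext i j; fin_cases i <;> fin_cases j <;> simp [this])
    (fun g => by
      rw [smul_conjTraceZero, conjTraceZero_add, adZero_conjTraceZero_iff r B g (hr g)]
      have := hd g
      ext i j
      fin_cases i <;> fin_cases j <;> simp [Matrix.mul_apply, Fin.sum_univ_two, this]
      ring)
    g₀ (by rwa [Ne, div_eq_one_iff_eq (hd g₀)]) hss
  intro hb
  rw [hb, Submodule.mem_bot, smul_conjTraceZero, conjTraceZero_add, ← conjTraceZero_zero B,
    conjTraceZero_inj] at hx
  simp at hx

theorem adZero_invariants_ne_bot_iff_of_triangular (h2 : (2 : k) ≠ 0) (L : Type*) [Field L]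
    [Algebra k L] (r : G →* GL (Fin 2) k) (B : GL (Fin 2) k) (a c d : G → k)
    (hr : ∀ g, (B * r g * B⁻¹).val = !![a g, c g; 0, d g]) (g₀ : G) (hg₀ : a g₀ ≠ d g₀) :
    (adZero r).invariants ≠ ⊥ ↔ (extendScalars L (adZero r)).IsSemisimpleRepresentation := by
  refine ⟨fun h => ?_, adZero_invariants_ne_bot_of_isSemisimple L r B a c d hr g₀ hg₀⟩
  obtain ⟨B', hB'⟩ := exists_diagonal_of_invariants_ne_bot h2 r B a c d hr g₀ hg₀ h
  exact extendScalars_adZero_isSemisimple_of_diagonal L r B' a d hB'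

end Adjoint

/-! ### A stable line in the residual representation. -/

section Triangular

/-- A two-dimensional representation with a common eigenvector is triangular in some basis. -/
theorem exists_triangular_of_eigenvector {G : Type*} {k : Type*} [Field k]
    (r : G → GL (Fin 2) k) (u : Fin 2 → k) (hu : u ≠ 0) (a : G → k)
    (h : ∀ g, (r g).val.mulVec u = a g • u) :
    ∃ (B : GL (Fin 2) k) (c d : G → k), ∀ g, (B * r g * B⁻¹).val = !![a g, c g; 0, d g] := by
  obtain ⟨C, hC⟩ : ∃ C : GL (Fin 2) k, C.val.mulVec ![1, 0] = u := by
    by_cases h0 : u 0 = 0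
    · have h1 : u 1 ≠ 0 := fun h1 => hu (by ext i; fin_cases i <;> simp [h0, h1])
      refine ⟨Matrix.GeneralLinearGroup.mkOfDetNeZero !![u 0, 1; u 1, 0] (by simpa), ?_⟩
      ext i; fin_cases i <;>
        simp [Matrix.mulVec, dotProduct, Fin.sum_univ_two, Matrix.GeneralLinearGroup.mkOfDetNeZero]
    · refine ⟨Matrix.GeneralLinearGroup.mkOfDetNeZero !![u 0, 0; u 1, 1] (by simpa), ?_⟩
      ext i; fin_cases i <;>
        simp [Matrix.mulVec, dotProduct, Fin.sum_univ_two, Matrix.GeneralLinearGroup.mkOfDetNeZero]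
  refine ⟨C⁻¹, fun g => (C⁻¹ * r g * C⁻¹⁻¹).val 0 1, fun g => (C⁻¹ * r g * C⁻¹⁻¹).val 1 1,
    fun g => ?_⟩
  beta_reduce
  have hcol : (C⁻¹ * r g * C⁻¹⁻¹).val.mulVec ![1, 0] = a g • ![1, 0] := by
    rw [inv_inv, Units.val_mul, Units.val_mul, ← Matrix.mulVec_mulVec, hC, ← Matrix.mulVec_mulVec,
      h, Matrix.mulVec_smul, ← hC, Matrix.mulVec_mulVec, ← Units.val_mul, inv_mul_cancel,
      Units.val_one, Matrix.one_mulVec]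
  generalize (C⁻¹ * r g * C⁻¹⁻¹).val = M at hcol ⊢
  have h0 := congrFun hcol 0
  have h1 := congrFun hcol 1
  simp [Matrix.mulVec, dotProduct, Fin.sum_univ_two] at h0 h1
  rw [Matrix.eta_fin_two M, h0, h1]
  simp

/-- Let `r` be a two-dimensional representation over a local domain `R`, triangular over an
extension `Ω` of the fraction field, where the ratio of the two diagonal characters at some `g₀` is
an element `e` of `R` with `e ^ 2 - 1` a unit. Then the residual representation is triangular,
with distinct diagonal characters at `g₀`. -/
theorem exists_residual_triangular {G : Type*} [Group G] {R Ω : Type*} [CommRing R] [IsLocalRing R]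
    [Field Ω] (φ : R →+* Ω) (hφ : Function.Injective φ) (r : G →* GL (Fin 2) R)
    (A : GL (Fin 2) Ω) (ε χ b : G → Ω)
    (hA : ∀ g, (A * Matrix.GeneralLinearGroup.map φ (r g) * A⁻¹).val = !![ε g * χ g, b g; 0, χ g])
    (g₀ : G) (e : R) (he : φ e = ε g₀) (hunit : IsUnit (e ^ 2 - 1)) :
    ∃ (B : GL (Fin 2) (IsLocalRing.ResidueField R)) (a c d : G → IsLocalRing.ResidueField R),
      (∀ g, (B * Matrix.GeneralLinearGroup.map (IsLocalRing.residue R) (r g) * B⁻¹).val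
        = !![a g, c g; 0, d g]) ∧ a g₀ ≠ d g₀ := by
  have hfac : (e ^ 2 - 1) = (e - 1) * (e + 1) := by ring
  rw [hfac, IsUnit.mul_iff] at hunit
  obtain ⟨hu1, w, hw⟩ := hunit
  set M := (r g₀).val with hM
  have e' : A⁻¹.val * A.val = 1 := by rw [← Units.val_mul, inv_mul_cancel, Units.val_one]
  have e'' : A.val * A⁻¹.val = 1 := by rw [← Units.val_mul, mul_inv_cancel, Units.val_one]
  have hA' : ∀ g, A.val * (r g).val.map φ * A⁻¹.val = !![ε g * χ g, b g; 0, χ g] := hA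
  have htr : φ M.trace = (φ e + 1) * χ g₀ := by
    have h := congrArg Matrix.trace (hA' g₀)
    rw [Matrix.trace_mul_comm, ← mul_assoc, e', one_mul, Matrix.trace_fin_two_of, ← he] at h
    rw [show φ M.trace = (M.map φ).trace from AddMonoidHom.map_trace φ.toAddMonoidHom M, h]
    ring
  have hdet : φ M.det = φ e * χ g₀ ^ 2 := by
    have h := congrArg Matrix.det (hA' g₀)
    rw [Matrix.det_mul_comm, ← mul_assoc, e', one_mul, Matrix.det_fin_two_of, ← he] at h
    rw [show φ M.det = (M.map φ).det from RingHom.map_det φ M, h]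
    ring
  -- Over `Ω` the trace is `(e + 1)χ(g₀)`, and `e + 1` is the unit `w`.
  set t : R := M.trace * ↑w⁻¹ with ht
  have htw : t * (e + 1) = M.trace := by rw [ht, ← hw, mul_assoc, Units.inv_mul, mul_one]
  have hφt : φ t = χ g₀ := by
    have hne : φ e + 1 ≠ 0 := by
      have : IsUnit (φ (e + 1)) := (hw ▸ w.isUnit).map φ
      simpa using this.ne_zero
    refine mul_right_cancel₀ hne ?_
    have := congrArg φ htw
    rw [map_mul, map_add, map_one, htr] at this
    rw [this, mul_comm]
  have hMdet : M.det = e * t ^ 2 := hφ (by rw [hdet, map_mul, map_pow, hφt])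
  have htu : IsUnit t := by
    have : IsUnit M.det := (Matrix.isUnit_iff_isUnit_det _).1 (r g₀).isUnit
    rw [hMdet, IsUnit.mul_iff] at this
    exact (isUnit_pow_iff two_ne_zero).1 this.2
  -- In the basis given by `A` the lower row of `D` vanishes, so its columns lie on the line with
  -- character `εχ`.
  set D : Matrix (Fin 2) (Fin 2) R := M - t • 1 with hD
  have hDtr : D.trace = (e - 1) * t := by
    rw [hD, Matrix.trace_sub, ← htw, Matrix.trace_smul, Matrix.trace_one]
    simp
    ring
  have hDmap : D.map φ = A⁻¹.val * !![(φ e - 1) * χ g₀, b g₀; 0, 0] * A.val := by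
    have h1 : D.map φ = M.map φ - χ g₀ • 1 := by
      rw [← hφt]
      ext i j; fin_cases i <;> fin_cases j <;> simp [hD]
    have h2 : !![(φ e - 1) * χ g₀, b g₀; 0, 0] = !![ε g₀ * χ g₀, b g₀; 0, χ g₀] - χ g₀ • 1 := by
      rw [he]
      ext i j; fin_cases i <;> fin_cases j <;> simp [sub_mul]
    rw [h1, h2, ← hA' g₀, mul_sub, sub_mul, mul_smul_comm, mul_one, smul_mul_assoc, e']
    congr 1
    calc M.map φ = (A⁻¹.val * A.val) * M.map φ * (A⁻¹.val * A.val) := by rw [e', one_mul, mul_one]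
      _ = _ := by simp only [mul_assoc, hM]
  have hDeig : ∀ g, (r g).val.map φ * D.map φ = (ε g * χ g) • D.map φ := fun g => by
    have h1 : (r g).val.map φ = A⁻¹.val * !![ε g * χ g, b g; 0, χ g] * A.val := by
      rw [← hA' g]
      calc _ = (A⁻¹.val * A.val) * (r g).val.map φ * (A⁻¹.val * A.val) := by
            rw [e', one_mul, mul_one]
        _ = _ := by simp only [mul_assoc]
    rw [h1, hDmap, ← smul_mul_assoc, ← mul_smul_comm]
    calc _ = A⁻¹.val * (!![ε g * χ g, b g; 0, χ g] * (A.val * A⁻¹.val) *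
          !![(φ e - 1) * χ g₀, b g₀; 0, 0]) * A.val := by simp only [mul_assoc]
      _ = _ := by
        rw [e'', mul_one]
        congr 2
        ext i j; fin_cases i <;> fin_cases j <;> simp
  obtain ⟨y, hy⟩ : IsUnit D.trace := hDtr ▸ hu1.mul htu
  -- Taking traces in `r(g)D = ε(g)χ(g)D` and dividing by the unit `tr D` shows that `εχ` takes
  -- values in `R`.
  let α : G → R := fun g => ((r g).val * D).trace * ↑y⁻¹
  have hα : ∀ g, φ (α g) = ε g * χ g := fun g => by
    have h1 := congrArg Matrix.trace (hDeig g)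
    rw [← Matrix.map_mul, Matrix.trace_smul, smul_eq_mul] at h1
    have h2 : ∀ N : Matrix (Fin 2) (Fin 2) R, (N.map φ).trace = φ N.trace := fun N =>
      (AddMonoidHom.map_trace φ.toAddMonoidHom N).symm
    rw [h2, h2, ← hy] at h1
    rw [show α g = ((r g).val * D).trace * ↑y⁻¹ from rfl, map_mul, h1, mul_assoc, ← map_mul,
      Units.mul_inv, map_one, mul_one]
  have hDR : ∀ g, (r g).val * D = α g • D := fun g => by
    refine Matrix.map_injective hφ ?_
    change ((r g).val * D).map φ = (α g • D).map φ
    rw [Matrix.map_mul, hDeig, ← hα]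
    ext i j; simp
  set π := IsLocalRing.residue R
  have hDbar : ∀ g, (r g).val.map π * D.map π = π (α g) • D.map π := fun g => by
    rw [← Matrix.map_mul, hDR]
    ext i j; simp
  -- The reduction of `D` has nonzero trace, hence a nonzero column: the required common
  -- eigenvector.
  obtain ⟨j, hj⟩ : ∃ j, (fun i => D.map π i j) ≠ 0 := by
    by_contra! hcon
    have : (D.map π).trace = 0 := by
      rw [Matrix.trace_fin_two, show D.map π 0 0 = 0 from congrFun (hcon 0) 0,
        show D.map π 1 1 = 0 from congrFun (hcon 1) 1, add_zero]
    rw [show (D.map π).trace = π D.trace from (AddMonoidHom.map_trace π.toAddMonoidHom D).symm,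
      ← hy] at this
    exact (y.isUnit.map π).ne_zero this
  obtain ⟨B, c, d, hB⟩ := exists_triangular_of_eigenvector
    (fun g => Matrix.GeneralLinearGroup.map π (r g)) _ hj (fun g => π (α g)) fun g => by
      ext i
      exact congrFun (congrFun (hDbar g) i) j
  refine ⟨B, fun g => π (α g), c, d, hB, fun hcontra => ?_⟩
  have hB0 : B.val * M.map π * B⁻¹.val = !![π (α g₀), c g₀; 0, d g₀] := hB g₀
  have f' : B⁻¹.val * B.val = 1 := by rw [← Units.val_mul, inv_mul_cancel, Units.val_one]
  have htr' : π M.trace = π (α g₀) + d g₀ := by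
    have h := congrArg Matrix.trace hB0
    rw [Matrix.trace_mul_comm, ← mul_assoc, f', one_mul, Matrix.trace_fin_two_of] at h
    rw [show π M.trace = (M.map π).trace from AddMonoidHom.map_trace π.toAddMonoidHom M, h]
  have hdet' : π M.det = π (α g₀) * d g₀ := by
    have h := congrArg Matrix.det hB0
    rw [Matrix.det_mul_comm, ← mul_assoc, f', one_mul, Matrix.det_fin_two_of] at h
    rw [show π M.det = (M.map π).det from RingHom.map_det π M, h]
    ring
  -- The discriminant `tr² - 4 det` of `M` is `((e - 1)t)²`; equal residual eigenvalues would make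
  -- it vanish modulo the maximal ideal.
  have hz : (π ((e - 1) * t)) ^ 2 = 0 := by
    have h1 : (e - 1) * t * ((e - 1) * t) = M.trace ^ 2 - 4 * M.det := by
      rw [hMdet, ← htw]; ring
    rw [sq, ← map_mul, h1, map_sub, map_pow, map_mul, htr', hdet', ← hcontra]
    simp only [map_ofNat]
    ring
  exact ((hu1.mul htu).map π).ne_zero (pow_eq_zero_iff two_ne_zero |>.1 hz)

/-- The variant of `exists_residual_triangular` for a representation `ρ` over a field containing
`R`, an integral model `ρ₀` of `ρ`, and a conjugate `s` of the reduction of `ρ₀`. -/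
theorem exists_triangular_of_integral_model {G : Type*} [Group G] {R E Ω : Type*} [CommRing R]
    [IsLocalRing R] [Field E] [Field Ω] (j : R →+* E) (hj : Function.Injective j) (ι : E →+* Ω)
    (ρ : G →* GL (Fin 2) E) (ρ₀ : G →* GL (Fin 2) R) (A₀ : GL (Fin 2) E)
    (hρ₀ : ∀ g, Matrix.GeneralLinearGroup.map j (ρ₀ g) = A₀ * ρ g * A₀⁻¹)
    (s : G →* GL (Fin 2) (IsLocalRing.ResidueField R)) (A₁ : GL (Fin 2) (IsLocalRing.ResidueField R))
    (hs : ∀ g, s g = A₁ * Matrix.GeneralLinearGroup.map (IsLocalRing.residue R) (ρ₀ g) * A₁⁻¹)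
    (A : GL (Fin 2) Ω) (ε : G → E) (χ b : G → Ω)
    (hA : ∀ g, (A * Matrix.GeneralLinearGroup.map ι (ρ g) * A⁻¹).val =
      !![ι (ε g) * χ g, b g; 0, χ g])
    (g₀ : G) (e : R) (he : j e = ε g₀) (hunit : IsUnit (e ^ 2 - 1)) :
    ∃ (B : GL (Fin 2) (IsLocalRing.ResidueField R)) (a c d : G → IsLocalRing.ResidueField R),
      (∀ g, (B * s g * B⁻¹).val = !![a g, c g; 0, d g]) ∧ a g₀ ≠ d g₀ := by
  obtain ⟨B, a, c, d, hB, hne⟩ := exists_residual_triangular (ι.comp j) (ι.injective.comp hj) ρ₀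
    (A * (Matrix.GeneralLinearGroup.map ι A₀)⁻¹) (fun g => ι (ε g)) χ b (fun g => by
      have h1 : Matrix.GeneralLinearGroup.map (ι.comp j) (ρ₀ g) =
          Matrix.GeneralLinearGroup.map ι A₀ * Matrix.GeneralLinearGroup.map ι (ρ g) *
            (Matrix.GeneralLinearGroup.map ι A₀)⁻¹ := by
        rw [← map_mul, ← map_inv, ← map_mul, ← hρ₀ g]
        rfl
      rw [← hA g, h1]
      congr 1
      group) g₀ e (congrArg ι he) hunit
  refine ⟨B * A₁⁻¹, a, c, d, fun g => ?_, hne⟩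
  rw [← hB g, hs]
  congr 1
  group

end Triangular

/-! ### Frobenius elements and their cyclotomic character. -/

section Frobenius

/-- Existence of Frobenius elements for a profinite group `G` acting on `S` with fixed ring `R`. -/
theorem exists_isArithFrobAt_of_profinite (R : Type*) {S G : Type*} [CommRing R] [CommRing S]
    [Algebra R S] [Group G] [MulSemiringAction G S] [SMulCommClass G R S]
    [TopologicalSpace G] [CompactSpace G] [TotallyDisconnectedSpace G] [IsTopologicalGroup G]
    (hopen : ∀ x : S, IsOpen (MulAction.stabilizer G x : Set G)) [Algebra.IsInvariant R S G]
    [Algebra.IsIntegral R S] (Q : Ideal S) [Q.IsPrime] [Finite (R ⧸ Q.under R)] :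
    ∃ σ : G, IsArithFrobAt R σ Q := by
  let _ : TopologicalSpace S := ⊥
  have : DiscreteTopology S := ⟨rfl⟩
  have : ContinuousSMul G S := continuousSMul_iff_stabilizer_isOpen.2 hopen
  let P := Q.under R
  have : P.IsPrime := inferInstance
  have hPmax : P.IsMaximal :=
    Ideal.Quotient.maximal_of_isField _ (Finite.isField_of_domain (R ⧸ P))
  let _ : Field (R ⧸ P) := Ideal.Quotient.field P
  obtain ⟨p, hc⟩ := CharP.exists (R ⧸ P)
  cases nonempty_fintype (R ⧸ P)
  obtain ⟨n, hp, hn⟩ := FiniteField.card (R ⧸ P) p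
  have : Q.IsMaximal := Ideal.isMaximal_of_isIntegral_of_isMaximal_comap (R := R) Q hPmax
  let _ : Field (S ⧸ Q) := Ideal.Quotient.field Q
  have : Algebra.IsAlgebraic (R ⧸ P) (S ⧸ Q) := inferInstance
  -- The power map by the cardinality of `R ⧸ P` is an automorphism because the residue extension is
  -- algebraic; it lifts since the stabilizer of `Q` surjects onto the residual automorphisms.
  let f : (S ⧸ Q) →ₐ[R ⧸ P] S ⧸ Q := FiniteField.frobeniusAlgHom (R ⧸ P) (S ⧸ Q)
  let σ' : (S ⧸ Q) ≃ₐ[R ⧸ P] S ⧸ Q := AlgEquiv.ofBijective f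
    (Algebra.IsAlgebraic.algHom_bijective f)
  obtain ⟨σ, hσ⟩ := Ideal.Quotient.stabilizerHom_surjective_of_profinite (G := G) P Q σ'
  refine ⟨σ, fun x ↦ ?_⟩
  rw [← Ideal.Quotient.eq, Nat.card_eq_fintype_card]
  exact DFunLike.congr_fun hσ (Ideal.Quotient.mk Q x)

variable {F : Type*} [Field F]

/-- The stabilizer contains the subgroup fixing the finite extension `F(x)`. -/
theorem stabilizer_ringOfIntegers_isOpen (x : 𝓞 (AlgebraicClosure F)) :
    IsOpen (MulAction.stabilizer Gal(AlgebraicClosure F/F) x : Set Gal(AlgebraicClosure F/F)) := by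
  let E := IntermediateField.adjoin F {(x : AlgebraicClosure F)}
  have : FiniteDimensional F E :=
    IntermediateField.adjoin.finiteDimensional (Algebra.IsIntegral.isIntegral _)
  refine Subgroup.isOpen_mono (H₁ := E.fixingSubgroup) (fun g hg => ?_)
    E.fixingSubgroup_isOpen
  refine RingOfIntegers.ext ?_
  exact hg ⟨x, IntermediateField.mem_adjoin_simple_self F _⟩

variable [NumberField F]

instance smulCommClass_ringOfIntegers :
    SMulCommClass Gal(AlgebraicClosure F/F) (𝓞 F) (𝓞 (AlgebraicClosure F)) where
  smul_comm g a x := by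
    refine RingOfIntegers.ext ?_
    change g ((a • x : 𝓞 (AlgebraicClosure F)) : AlgebraicClosure F) = _
    rw [Algebra.smul_def, Algebra.smul_def]
    change g (algebraMap F (AlgebraicClosure F) (a : F) * (x : AlgebraicClosure F)) =
      algebraMap F (AlgebraicClosure F) (a : F) * g x
    rw [map_mul, AlgEquiv.commutes]

instance isInvariant_ringOfIntegers :
    Algebra.IsInvariant (𝓞 F) (𝓞 (AlgebraicClosure F)) Gal(AlgebraicClosure F/F) where
  isInvariant x hx := by
    obtain ⟨y, hy⟩ := (InfiniteGalois.mem_bot_iff_fixed (k := F) (x : AlgebraicClosure F)).2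
      fun g => congrArg (fun z : 𝓞 (AlgebraicClosure F) => (z : AlgebraicClosure F)) (hx g)
    have hyint : IsIntegral ℤ y := by
      have h : IsIntegral ℤ (x : AlgebraicClosure F) := RingOfIntegers.isIntegral_coe x
      rw [← hy] at h
      exact (isIntegral_algebraMap_iff (algebraMap F (AlgebraicClosure F)).injective).1 h
    exact ⟨⟨y, hyint⟩, RingOfIntegers.ext hy⟩

theorem exists_frobenius (v : HeightOneSpectrum (𝓞 F)) (P : Ideal (𝓞 (AlgebraicClosure F)))
    [P.IsPrime] [P.LiesOver v.asIdeal] :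
    ∃ σ : Gal(AlgebraicClosure F/F), IsArithFrobAt (𝓞 F) σ P := by
  have : Finite (𝓞 F ⧸ P.under (𝓞 F)) := by
    rw [← P.over_def v.asIdeal]
    infer_instance
  exact exists_isArithFrobAt_of_profinite (𝓞 F) stabilizer_ringOfIntegers_isOpen P

/-- If `ℓ` is invertible modulo `P`, the `ℓ`-adic cyclotomic character of a Frobenius element at
`P` is congruent to the cardinality of the residue field modulo `ℓ`. -/
theorem toZMod_cyclotomicCharacter_frobenius (ℓ : ℕ) [Fact ℓ.Prime]
    (P : Ideal (𝓞 (AlgebraicClosure F))) (hP : (ℓ : 𝓞 (AlgebraicClosure F)) ∉ P)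
    (σ : Gal(AlgebraicClosure F/F)) (hσ : IsArithFrobAt (𝓞 F) σ P) :
    PadicInt.toZModPow 1 (cyclotomicCharacter (AlgebraicClosure F) ℓ σ.toRingEquiv : ℤ_[ℓ]) =
      (Nat.card (𝓞 F ⧸ P.under (𝓞 F)) : ZMod (ℓ ^ 1)) := by
  have hℓ : ℓ ≠ 0 := (Fact.out : ℓ.Prime).ne_zero
  obtain ⟨ζ, hζ⟩ := HasEnoughRootsOfUnity.exists_primitiveRoot (AlgebraicClosure F) (ℓ ^ 1)
  have hspec := cyclotomicCharacter.spec ℓ σ.toRingEquiv ζ hζ.pow_eq_one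
  have hint : IsIntegral ℤ ζ := hζ.isIntegral (by positivity)
  let z : 𝓞 (AlgebraicClosure F) := ⟨ζ, hint⟩
  have hz : z ^ ℓ = 1 := RingOfIntegers.ext (by
    have := hζ.pow_eq_one
    rw [pow_one] at this
    exact this)
  -- Since `ℓ ∉ P`, the Frobenius congruence is an equality on `ℓ`-th roots of unity.
  have hfrob := AlgHom.IsArithFrobAt.apply_of_pow_eq_one hσ hz hP
  have hfrob' : σ ζ = ζ ^ Nat.card (𝓞 F ⧸ P.under (𝓞 F)) :=
    congrArg (fun z : 𝓞 (AlgebraicClosure F) => (z : AlgebraicClosure F)) hfrob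
  have heq := hspec.symm.trans hfrob'
  refine ZMod.val_injective (ℓ ^ 1) ?_
  rw [← pow_mod_orderOf, ← pow_mod_orderOf ζ (Nat.card _), ← hζ.eq_orderOf,
    Nat.mod_eq_of_lt (ZMod.val_lt _)] at heq
  rw [ZMod.val_natCast]
  exact hζ.pow_inj (ZMod.val_lt _) (Nat.mod_lt _ (by positivity)) heq

end Frobenius

/-! ### Reduction modulo `λ` of the cyclotomic character. -/

section Cyclotomic

variable {K : Type*} [Field K] [NumberField K] (l : HeightOneSpectrum (𝓞 K))
  (ℓ : ℕ) [Fact ℓ.Prime] (hl : (ℓ : 𝓞 K) ∈ l.asIdeal)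

theorem padicIntHom_continuous : Continuous (padicIntHom l ℓ hl) :=
  (uniformContinuous_uniformly_extend (e := (Int.castRingHom ℤ_[ℓ]).range.subtype)
    (isUniformInducing_val _)
    ((PadicInt.denseRange_intCast (p := ℓ)).mono (by
      rintro _ ⟨n, rfl⟩
      exact ⟨⟨(n : ℤ_[ℓ]), n, rfl⟩, rfl⟩))
    (intRangeHom_uniformContinuous l ℓ hl)).continuous

/-- By continuity: `ℤ` is dense in `ℤ_ℓ` and the valuation ring is closed. -/
theorem padicIntHom_mem_integers (x : ℤ_[ℓ]) :
    padicIntHom l ℓ hl x ∈ l.adicCompletionIntegers K := by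
  have hcl : IsClosed ((l.adicCompletionIntegers K : Set (l.adicCompletion K))) :=
    Valued.isClosed_valuationSubring _
  refine (PadicInt.denseRange_intCast (p := ℓ)).induction_on (p := fun x =>
    padicIntHom l ℓ hl x ∈ l.adicCompletionIntegers K) x
    (hcl.preimage (padicIntHom_continuous l ℓ hl)) fun n => ?_
  rw [map_intCast]
  exact intCast_mem _ n

theorem residue_algebraMap_eq_zero_iff (x : 𝓞 K) :
    IsLocalRing.residue (l.adicCompletionIntegers K)
      (algebraMap (𝓞 K) (l.adicCompletionIntegers K) x) = 0 ↔ x ∈ l.asIdeal := by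
  rw [IsLocalRing.residue_eq_zero_iff, IsLocalRing.mem_maximalIdeal, mem_nonunits_iff,
    HeightOneSpectrum.adicCompletionIntegers.isUnit_iff_valued_eq_one,
    ← l.valuation_lt_one_iff_mem (K := K), lt_iff_le_and_ne,
    ← HeightOneSpectrum.valuedAdicCompletion_eq_valuation]
  exact ⟨fun h => ⟨(HeightOneSpectrum.mem_adicCompletionIntegers (𝓞 K) K l).1
    (algebraMap (𝓞 K) (l.adicCompletionIntegers K) x).2, h⟩, fun h => h.2⟩

/-- If `x` is congruent to the integer `n` modulo `ℓ`, its image in the residue field of `λ`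
is `n`. -/
theorem exists_padicIntHom_eq_of_toZModPow (x : ℤ_[ℓ]) (n : ℕ)
    (hx : PadicInt.toZModPow 1 x = (n : ZMod (ℓ ^ 1))) :
    ∃ e : l.adicCompletionIntegers K, (e : l.adicCompletion K) = padicIntHom l ℓ hl x ∧
      IsLocalRing.residue (l.adicCompletionIntegers K) e = n := by
  have hmem : x - n ∈ Ideal.span {(ℓ : ℤ_[ℓ]) ^ 1} := by
    rw [← PadicInt.ker_toZModPow, RingHom.mem_ker, map_sub, hx, map_natCast, sub_self]
  obtain ⟨y, hy⟩ := Ideal.mem_span_singleton.1 hmem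
  rw [pow_one, sub_eq_iff_eq_add] at hy
  refine ⟨⟨padicIntHom l ℓ hl x, padicIntHom_mem_integers l ℓ hl x⟩, rfl, ?_⟩
  have : (⟨padicIntHom l ℓ hl x, padicIntHom_mem_integers l ℓ hl x⟩ : l.adicCompletionIntegers K) =
      ℓ * ⟨padicIntHom l ℓ hl y, padicIntHom_mem_integers l ℓ hl y⟩ + n := by
    refine Subtype.ext ?_
    change padicIntHom l ℓ hl x = ℓ * padicIntHom l ℓ hl y + n
    rw [hy, map_add, map_mul, map_natCast, map_natCast]
  have hℓ := (residue_algebraMap_eq_zero_iff l (ℓ : 𝓞 K)).2 hl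
  rw [map_natCast, map_natCast] at hℓ
  rw [this, map_add, map_mul, map_natCast, map_natCast, hℓ, zero_mul, zero_add]

end Cyclotomic

/-- A prime of `𝓞 F̄` above `v` does not contain a prime number `ℓ` that does not divide
`#(𝓞 F / v)`. -/
theorem natCast_notMem_of_not_dvd_card {F : Type*} [Field F] [NumberField F]
    (v : HeightOneSpectrum (𝓞 F)) (P : Ideal (𝓞 (AlgebraicClosure F))) [P.LiesOver v.asIdeal]
    (ℓ : ℕ) [Fact ℓ.Prime] (h : ¬ ℓ ∣ Nat.card (𝓞 F ⧸ v.asIdeal)) :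
    (ℓ : 𝓞 (AlgebraicClosure F)) ∉ P := by
  intro hmem
  have hv : (ℓ : 𝓞 F) ∈ v.asIdeal := by
    rw [P.over_def v.asIdeal, Ideal.mem_comap, map_natCast]
    exact hmem
  -- The residue field at `v` would have characteristic `ℓ`, and a finite ring is killed by its
  -- cardinality.
  have : CharP (𝓞 F ⧸ v.asIdeal) ℓ := by
    refine (CharP.charP_iff_prime_eq_zero Fact.out).2 ?_
    rw [← map_natCast (Ideal.Quotient.mk v.asIdeal)]
    exact Ideal.Quotient.eq_zero_iff_mem.2 hv
  refine h ?_
  rw [← CharP.cast_eq_zero_iff (𝓞 F ⧸ v.asIdeal) ℓ]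
  cases nonempty_fintype (𝓞 F ⧸ v.asIdeal)
  rw [Nat.card_eq_fintype_card]
  exact Nat.cast_card_eq_zero _

end SpecialAdjoint

/-! ### The main theorem. -/

open SpecialAdjoint in
theorem lemma3p4 {F : Type*} [Field F] [NumberField F] {K : Type*} [Field K] [NumberField K]
    (v : HeightOneSpectrum (𝓞 F))
    (P : Ideal (𝓞 (AlgebraicClosure F))) [P.IsPrime] [P.LiesOver v.asIdeal]
    (l : HeightOneSpectrum (𝓞 K)) (ℓ : ℕ) [Fact ℓ.Prime] (hl : (ℓ : 𝓞 K) ∈ l.asIdeal)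
    (ρ : Gal(AlgebraicClosure F/F) →* GL (Fin 2) (l.adicCompletion K)) (hρ : Continuous ρ)
    (hspecial : IsSpecialAt l ℓ hl P ρ)
    (ρ' : Gal(AlgebraicClosure F/F) →* GL (Fin 2) (resField l))
    (hρ' : IsSemisimpleReduction l ρ ρ')
    (q : ℕ) (hq : q = Nat.card (𝓞 F ⧸ v.asIdeal))
    (hlq : (2 * ((q : 𝓞 K) ^ 2 - 1) * (q : 𝓞 K)) ∉ l.asIdeal) :
    (adZero (ρ'.comp (decompositionGroup F P).subtype)).invariants ≠ ⊥ ↔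
      (extendScalars (AlgebraicClosure (resField l))
        (adZero (ρ'.comp (decompositionGroup F P).subtype))).IsSemisimpleRepresentation := by
  have hres : (2 : resField l) * ((q : resField l) ^ 2 - 1) * (q : resField l) ≠ 0 := by
    rw [← residue_algebraMap_eq_zero_iff] at hlq
    simpa only [map_mul, map_sub, map_pow, map_natCast, map_ofNat, map_one] using hlq
  have h2 : (2 : resField l) ≠ 0 := left_ne_zero_of_mul (left_ne_zero_of_mul hres)
  obtain ⟨ρ₀, A₀, hρ₀, hss⟩ := hρ'
  -- Irreducibility here concerns the full Galois group: in the first case `ρ'` is conjugate to the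
  -- reduction and the local structure matters, while in the second `ρ'` is already diagonal.
  rcases hss with ⟨-, A₁, hA₁⟩ | ⟨a, b, c, A, B, hAB⟩
  · obtain ⟨σ, hσ⟩ := exists_frobenius v P
    let g₀ : decompositionGroup F P := ⟨σ, hσ.mem_stabilizer⟩
    -- The factor `q` of the hypothesis enters here: if `ℓ` divided `q`, then `q` would lie in `λ`.
    have hP : (ℓ : 𝓞 (AlgebraicClosure F)) ∉ P := by
      refine natCast_notMem_of_not_dvd_card v P ℓ fun ⟨m, hm⟩ => hlq ?_
      refine Ideal.mul_mem_left _ _ ?_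
      rw [hq, hm, Nat.cast_mul]
      exact Ideal.mul_mem_right _ _ hl
    have hfrob := toZMod_cyclotomicCharacter_frobenius ℓ P hP σ hσ
    rw [← P.over_def v.asIdeal, ← hq] at hfrob
    obtain ⟨e, he, heres⟩ := exists_padicIntHom_eq_of_toZModPow l ℓ hl _ q hfrob
    have hunit : IsUnit (e ^ 2 - 1) := by
      rw [← IsLocalRing.residue_ne_zero_iff_isUnit, map_sub, map_pow, heres, map_one]
      exact right_ne_zero_of_mul (left_ne_zero_of_mul hres)
    obtain ⟨χ, ⟨A, b, hA⟩, -⟩ := hspecial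
    obtain ⟨B, a, c, d, hB, hne⟩ := exists_triangular_of_integral_model
      (algebraMap (l.adicCompletionIntegers K) (l.adicCompletion K)) Subtype.val_injective
      (algebraMap (l.adicCompletion K) (AlgebraicClosure (l.adicCompletion K)))
      (ρ.comp (decompositionGroup F P).subtype) (ρ₀.comp (decompositionGroup F P).subtype) A₀
      (fun g => hρ₀ g) (ρ'.comp (decompositionGroup F P).subtype) A₁ (fun g => hA₁ g)
      A (fun g => cyclo l ℓ hl g.1) (fun g => χ g) b hA g₀ e he hunit
    exact adZero_invariants_ne_bot_iff_of_triangular h2 _ _ B a c d hB g₀ hne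
  · have hdiag : ∀ g : decompositionGroup F P,
        (B * (ρ'.comp (decompositionGroup F P).subtype) g * B⁻¹).val =
          !![(a g : resField l), 0; 0, (b g : resField l)] := fun g => (hAB g).2
    exact iff_of_true
      (adZero_invariants_ne_bot_of_diagonal _ B (fun g => a g) (fun g => b g) hdiag)
      (extendScalars_adZero_isSemisimple_of_diagonal _ _ B (fun g => a g) (fun g => b g) hdiag)
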